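/- All representations are over $\mathbb{C}$. Let $G$ be a finite group and $n$ a positive integer. Let $D(G)$ be the Drinfel'd double of $G$, i.e. the Hopf algebra with basis $e_g\bowtie h$ ($g,h\in G$), multiplication $(e_g\bowtie h)(e_{g'}\bowtie h')=\delta_{g,\,hg'h^{-1}}\,e_g\bowtie hh'$, unit $\sum_{g} e_g\bowtie 1$, comultiplication $\Delta(e_g\bowtie h)=\sum_{ab=g}(e_a\bowtie h)\otimes(e_b\bowtie h)$, counit $\varepsilon(e_g\bowtie h)=\delta_{g,1}$ and antipode $S(e_g\bowtie h)=e_{h^{-1}g^{-1}h}\bowtie h^{-1}$. Its normalized integral is $\Lambda=\frac1{|G|}\sum_{h\in G}e_1\bowtie h$. The $n$-th Frobenius–Schur indicator of an irreducible representation $V$ of $D(G)$ with character $\chi$ is $\nu_n(V)=\chi(\Lambda^{[n]})$, where $x^{[n]}=x_1x_2\cdots x_n$ is the $n$-th Sweedler power. The group $G$ is called an $FSZ_n$-group if $\nu_n(V)\in\mathbb{Z}$ for every irreducible representation $V$ of $D(G)$. For $u,g\in G$ put $G_n(u,g)=\{a\in G : (au^{-1})^n=a^n=g\}$, and let $C_G(u,g)$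 be the subgroup of elements commuting with both $u$ and $g$; for every integer $m$ it acts by conjugation on $G_n(u,g^m)$. The group $G$ is called an $FSZ^+_n$-group if for all commuting $u,g\in G$ and all integers $m$ with $\gcd(m,|G|)=1$, the $C_G(u,g)$-sets $G_n(u,g)$ and $G_n(u,g^m)$ afford isomorphic permutation modules over $\mathbb{C}$ for $C_G(u,g)$. Theorem. For every finite group $G$ and every positive integer $n$, the following are equivalent: (a) $G$ is an $FSZ^+_n$-group; (b) the centralizer of every nonidentity element of $G$ is an $FSZ_n$-group. -/

import Mathlib

universe u

noncomputable section

section HopfIndicators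

open scoped TensorProduct

/-- `Λ` is a normalized (two-sided) integral of the Hopf algebra `H`:
`h Λ = ε(h) Λ = Λ h` for all `h`, and `ε(Λ) = 1`. -/
def IsNormalizedIntegral {H : Type*} [Ring H] [HopfAlgebra ℂ H] (Λ : H) : Prop :=
  (∀ h : H, h * Λ = Coalgebra.counit (R := ℂ) h • Λ ∧ Λ * h = Coalgebra.counit (R := ℂ) h • Λ) ∧
    Coalgebra.counit (R := ℂ) Λ = (1 : ℂ)

theorem IsNormalizedIntegral.unique {H : Type*} [Ring H] [HopfAlgebra ℂ H] {Λ Λ' : H}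
    (h : IsNormalizedIntegral Λ) (h' : IsNormalizedIntegral Λ') : Λ = Λ' := by
  have h1 := (h.1 Λ').1
  have h2 := (h'.1 Λ).2
  rw [h'.2, one_smul] at h1
  rw [h.2, one_smul] at h2
  rw [← h1, h2]

/-- The Sweedler power `h ↦ h^[n] = h₁ h₂ ⋯ hₙ`, that is, the `n`-th power of the identity map in
the convolution algebra of linear endomorphisms of `H`. -/
def sweedlerPower (H : Type*) [Ring H] [HopfAlgebra ℂ H] (n : ℕ) : H →ₗ[ℂ] H :=
  ((WithConv.toConv (LinearMap.id : H →ₗ[ℂ] H)) ^ n).ofConv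

/-- For the normalized integral `Λ` of `H`, the `n`-th Frobenius-Schur indicator
`ν_n(V) = χ_V(Λ^[n])` of the `H`-module `V`. -/
def frobeniusSchurIndicator {H : Type*} [Ring H] [HopfAlgebra ℂ H] (Λ : H) (n : ℕ)
    (V : Type*) [AddCommGroup V] [Module ℂ V] [Module H V] [IsScalarTower ℂ H V] : ℂ :=
  LinearMap.trace ℂ V (Algebra.lsmul ℂ ℂ V (sweedlerPower H n Λ))

end HopfIndicators

/-- The underlying vector space of the Drinfel'd double `D(G) = ℂ^G ⋈ ℂG`. -/
def DrinfeldDouble (G : Type u) : Type u := (G × G) →₀ ℂ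

namespace DrinfeldDouble

open scoped TensorProduct

attribute [local instance] Fintype.ofFinite

open scoped Classical

instance (G : Type u) : AddCommGroup (DrinfeldDouble G) :=
  inferInstanceAs (AddCommGroup ((G × G) →₀ ℂ))

instance (G : Type u) : Module ℂ (DrinfeldDouble G) :=
  inferInstanceAs (Module ℂ ((G × G) →₀ ℂ))

/-- The basis vector `e_g ⋈ h`, where `e_g` is the indicator function of `g`. -/
def bas {G : Type u} (g h : G) : DrinfeldDouble G := Finsupp.single (g, h) (1 : ℂ)

/-- The linear map with prescribed values on the basis `e_g ⋈ h`. -/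
def lift {G : Type u} {M : Type*} [AddCommGroup M] [Module ℂ M] (f : G → G → M) :
    DrinfeldDouble G →ₗ[ℂ] M :=
  Finsupp.linearCombination ℂ (fun p : G × G => f p.1 p.2)

@[simp]
theorem lift_bas {G : Type u} {M : Type*} [AddCommGroup M] [Module ℂ M] (f : G → G → M)
    (g h : G) : lift f (bas g h) = f g h := by
  change Finsupp.linearCombination ℂ (fun p : G × G => f p.1 p.2) (Finsupp.single (g, h) 1) = _
  rw [Finsupp.linearCombination_single, one_smul]

theorem hom_ext {G : Type u} {M : Type*} [AddCommMonoid M] [Module ℂ M]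
    {f f' : DrinfeldDouble G →ₗ[ℂ] M} (h : ∀ a b, f (bas a b) = f' (bas a b)) : f = f' :=
  Finsupp.lhom_ext' (M := ℂ) (fun p => LinearMap.ext_ring (h p.1 p.2))

/-- The multiplication `(e_g ⋈ h)(e_g' ⋈ h') = δ_{g, h g' h⁻¹} e_g ⋈ hh'`. -/
def mulL (G : Type u) [Group G] :
    DrinfeldDouble G →ₗ[ℂ] DrinfeldDouble G →ₗ[ℂ] DrinfeldDouble G :=
  lift fun g h => lift fun g' h' => if g = h * g' * h⁻¹ then bas g (h * h') else 0

instance (G : Type u) [Group G] : Mul (DrinfeldDouble G) := ⟨fun x y => mulL G x y⟩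

theorem bas_mul_bas {G : Type u} [Group G] (g h g' h' : G) :
    (bas g h * bas g' h' : DrinfeldDouble G) =
      if g = h * g' * h⁻¹ then bas g (h * h') else 0 := by
  change mulL G (bas g h) (bas g' h') = _
  simp [mulL]

/-- The unit is `∑ g, e_g ⋈ 1`. -/
instance (G : Type u) [Group G] [Finite G] : One (DrinfeldDouble G) := ⟨∑ g : G, bas g 1⟩

theorem one_eq {G : Type u} [Group G] [Finite G] :
    (1 : DrinfeldDouble G) = ∑ g : G, bas g 1 := rfl

theorem mulL_assoc {G : Type u} [Group G] (x y z : DrinfeldDouble G) :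
    mulL G (mulL G x y) z = mulL G x (mulL G y z) := by
  have : (mulL G).compr₂ (mulL G) =
      (LinearMap.llcomp ℂ (DrinfeldDouble G) (DrinfeldDouble G) (DrinfeldDouble G) ∘ₗ
        mulL G).compl₂ (mulL G) := by
    refine hom_ext fun a b => hom_ext fun c d => hom_ext fun e f => ?_
    simp only [LinearMap.compr₂_apply, LinearMap.compl₂_apply, LinearMap.comp_apply,
      LinearMap.llcomp_apply]
    simp only [mulL, lift_bas]
    by_cases h1 : a = b * c * b⁻¹ <;> by_cases h2 : c = d * e * d⁻¹
    · subst h2; subst h1; simp [mul_assoc]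
    · have : ¬ (a = b * d * e * (b * d)⁻¹) := by
        subst h1
        intro h
        apply h2
        have := congrArg (fun t => b⁻¹ * t * b) h
        simpa [mul_assoc] using this
      rw [if_pos h1, if_neg h2, lift_bas, lift_bas, if_neg this, map_zero]
    · rw [if_neg h1, if_pos h2, lift_bas, if_neg h1, map_zero, LinearMap.zero_apply]
    · rw [if_neg h1, if_neg h2, map_zero, map_zero, LinearMap.zero_apply]
  exact congr($this x y z)

theorem mulL_one_left {G : Type u} [Group G] [Finite G] (x : DrinfeldDouble G) :
    mulL G 1 x = x := by
  have : mulL G 1 = LinearMap.id := by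
    refine hom_ext fun a b => ?_
    simp [one_eq, mulL]
  exact congr($this x)

theorem mulL_one_right {G : Type u} [Group G] [Finite G] (x : DrinfeldDouble G) :
    mulL G x 1 = x := by
  have : (mulL G).flip 1 = LinearMap.id := by
    refine hom_ext fun a b => ?_
    have key : ∀ g : G, (a = b * g * b⁻¹) = (g = b⁻¹ * a * b) := by
      intro g
      refine propext ⟨fun h => ?_, fun h => ?_⟩ <;> subst h <;> simp [mul_assoc]
    simp [one_eq, mulL, key]
  exact congr($this x)

instance (G : Type u) [Group G] [Finite G] : Ring (DrinfeldDouble G) where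
  left_distrib x y z := map_add (mulL G x) y z
  right_distrib x y z := congr($(map_add (mulL G) x y) z)
  zero_mul x := congr($(map_zero (mulL G)) x)
  mul_zero x := map_zero (mulL G x)
  mul_assoc := mulL_assoc
  one_mul := mulL_one_left
  mul_one := mulL_one_right
  neg_add_cancel := neg_add_cancel
  zsmul := (· • ·)
  zsmul_zero' := SubNegMonoid.zsmul_zero'
  zsmul_succ' := SubNegMonoid.zsmul_succ'
  zsmul_neg' := SubNegMonoid.zsmul_neg'
  nsmul := (· • ·)
  nsmul_zero := AddMonoid.nsmul_zero
  nsmul_succ := AddMonoid.nsmul_succ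
  sub_eq_add_neg := sub_eq_add_neg

instance (G : Type u) [Group G] [Finite G] : Algebra ℂ (DrinfeldDouble G) :=
  Algebra.ofModule (fun r x y => congr($(map_smul (mulL G) r x) y))
    (fun r x y => map_smul (mulL G x) r y)

/-- `Δ(e_g ⋈ h) = ∑_{ab = g} (e_a ⋈ h) ⊗ (e_b ⋈ h)` and `ε(e_g ⋈ h) = δ_{g, 1}`. -/
instance (G : Type u) [Group G] [Finite G] : CoalgebraStruct ℂ (DrinfeldDouble G) where
  comul := lift fun g h => ∑ a : G, bas a h ⊗ₜ[ℂ] bas (a⁻¹ * g) h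
  counit := lift fun g _ => if g = 1 then 1 else 0

theorem comul_bas {G : Type u} [Group G] [Finite G] (g h : G) :
    Coalgebra.comul (R := ℂ) (bas g h) = ∑ a : G, bas a h ⊗ₜ[ℂ] bas (a⁻¹ * g) h :=
  lift_bas _ g h

theorem counit_bas {G : Type u} [Group G] [Finite G] (g h : G) :
    Coalgebra.counit (R := ℂ) (bas g h) = if g = 1 then (1 : ℂ) else 0 :=
  lift_bas _ g h

instance (G : Type u) [Group G] [Finite G] : Coalgebra ℂ (DrinfeldDouble G) where
  coassoc := by
    refine hom_ext fun g h => ?_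
    simp only [LinearMap.comp_apply, comul_bas, map_sum, LinearMap.rTensor_tmul,
      LinearMap.lTensor_tmul, TensorProduct.sum_tmul, TensorProduct.tmul_sum,
      LinearEquiv.coe_coe, TensorProduct.assoc_tmul]
    rw [Finset.sum_comm]
    refine Finset.sum_congr rfl fun a _ => ?_
    refine Fintype.sum_equiv (Equiv.mulLeft a⁻¹) _ _ fun b => ?_
    simp [mul_assoc]
  rTensor_counit_comp_comul := by
    refine hom_ext fun g h => ?_
    simp [comul_bas, counit_bas, TensorProduct.ite_tmul]
  lTensor_counit_comp_comul := by
    refine hom_ext fun g h => ?_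
    simp [comul_bas, counit_bas, TensorProduct.tmul_ite, inv_mul_eq_one]

theorem counit_mul' {G : Type u} [Group G] [Finite G] (x y : DrinfeldDouble G) :
    Coalgebra.counit (R := ℂ) (x * y) =
      Coalgebra.counit (R := ℂ) x * Coalgebra.counit (R := ℂ) y := by
  have : (LinearMap.mul ℂ (DrinfeldDouble G)).compr₂ (Coalgebra.counit (R := ℂ)) =
      (LinearMap.mul ℂ ℂ).compl₁₂ (Coalgebra.counit (R := ℂ)) (Coalgebra.counit (R := ℂ)) := by
    refine hom_ext fun a b => hom_ext fun c d => ?_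
    simp only [LinearMap.compr₂_apply, LinearMap.compl₁₂_apply, LinearMap.mul_apply',
      bas_mul_bas, counit_bas]
    by_cases hc : c = 1
    · subst hc
      by_cases ha : a = 1 <;> simp [ha, counit_bas]
    · by_cases ha : a = 1
      · have : ¬ (1 = b * c * b⁻¹) := by
          intro h
          apply hc
          have := congrArg (fun t => b⁻¹ * t * b) h
          simpa [mul_assoc] using this.symm
        simp [hc, ha, this]
      · by_cases h : a = b * c * b⁻¹
        · rw [if_pos h, counit_bas]; simp [ha]
        · rw [if_neg h]; simp [ha]
  exact congr($this x y)

theorem comul_mul' {G : Type u} [Group G] [Finite G] (x y : DrinfeldDouble G) :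
    Coalgebra.comul (R := ℂ) (x * y) =
      Coalgebra.comul (R := ℂ) x * Coalgebra.comul (R := ℂ) y := by
  have : (LinearMap.mul ℂ (DrinfeldDouble G)).compr₂ (Coalgebra.comul (R := ℂ)) =
      (LinearMap.mul ℂ (DrinfeldDouble G ⊗[ℂ] DrinfeldDouble G)).compl₁₂
        (Coalgebra.comul (R := ℂ)) (Coalgebra.comul (R := ℂ)) := by
    refine hom_ext fun a b => hom_ext fun c d => ?_
    have key : ∀ s t : G, (s = b * t * b⁻¹) = (t = b⁻¹ * s * b) := by
      intro s t
      refine propext ⟨fun h => ?_, fun h => ?_⟩ <;> subst h <;> simp [mul_assoc]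
    simp only [LinearMap.compr₂_apply, LinearMap.compl₁₂_apply, LinearMap.mul_apply',
      bas_mul_bas, comul_bas, Finset.sum_mul_sum, Algebra.TensorProduct.tmul_mul_tmul, key,
      TensorProduct.ite_tmul, Finset.sum_ite_eq', Finset.mem_univ, if_true]
    by_cases h : c = b⁻¹ * a * b
    · subst h
      simp [comul_bas, mul_assoc]
    · have h' : ∀ s : G, ¬ ((b⁻¹ * s * b)⁻¹ * c = b⁻¹ * (s⁻¹ * a) * b) := by
        intro s hs
        apply h
        have := congrArg (fun t => (b⁻¹ * s * b) * t) hs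
        simpa [mul_assoc] using this
      simp only [if_neg h, if_neg (h' _), map_zero, TensorProduct.tmul_zero,
        Finset.sum_const_zero]
  exact congr($this x y)

instance (G : Type u) [Group G] [Finite G] : Bialgebra ℂ (DrinfeldDouble G) :=
  Bialgebra.mk' ℂ (DrinfeldDouble G)
    (by simp [one_eq, counit_bas])
    (counit_mul' _ _)
    (by
      simp only [one_eq, map_sum, comul_bas, Algebra.TensorProduct.one_def,
        TensorProduct.sum_tmul, TensorProduct.tmul_sum]
      conv_lhs => rw [Finset.sum_comm]
      conv_rhs => rw [Finset.sum_comm]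
      refine Finset.sum_congr rfl fun a _ => ?_
      exact Fintype.sum_equiv (Equiv.mulLeft a⁻¹) _ _ fun b => rfl)
    (comul_mul' _ _)

/-- The antipode `S(e_g ⋈ h) = e_{h⁻¹ g⁻¹ h} ⋈ h⁻¹`. -/
instance (G : Type u) [Group G] [Finite G] : HopfAlgebra ℂ (DrinfeldDouble G) where
  antipode := lift fun g h => bas (h⁻¹ * g⁻¹ * h) h⁻¹
  mul_antipode_rTensor_comul := by
    refine hom_ext fun g h => ?_
    simp only [LinearMap.comp_apply, comul_bas, counit_bas, map_sum, LinearMap.rTensor_tmul,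
      lift_bas, LinearMap.mul'_apply, bas_mul_bas, Algebra.linearMap_apply]
    have key : ∀ a : G, (h⁻¹ * a⁻¹ * h = h⁻¹ * (a⁻¹ * g) * h⁻¹⁻¹) = (g = 1) := by
      intro a
      simp [mul_assoc]
    simp only [key]
    by_cases hg : g = 1
    · simp only [hg, if_true, map_one, one_eq, inv_mul_cancel]
      refine Fintype.sum_equiv
        ((Equiv.inv G).trans ((Equiv.mulLeft h⁻¹).trans (Equiv.mulRight h))) _ _ fun b => ?_
      simp
    · simp [hg]
  mul_antipode_lTensor_comul := by
    refine hom_ext fun g h => ?_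
    simp only [LinearMap.comp_apply, comul_bas, counit_bas, map_sum, LinearMap.lTensor_tmul,
      lift_bas, LinearMap.mul'_apply, bas_mul_bas, Algebra.linearMap_apply]
    have key : ∀ a : G, (a = h * (h⁻¹ * (a⁻¹ * g)⁻¹ * h) * h⁻¹) = (g = 1) := by
      intro a
      refine propext ⟨fun h1 => ?_, fun h1 => ?_⟩
      · have := congrArg (fun t => g * t * a⁻¹) h1
        simpa [mul_assoc] using this
      · subst h1; simp [mul_assoc]
    simp only [key]
    by_cases hg : g = 1
    · simp [hg, one_eq]
    · simp [hg]

/-- The normalized integral `|G|⁻¹ ∑ h, e_1 ⋈ h` of `D(G)`. -/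
def integral (G : Type u) [Group G] [Finite G] : DrinfeldDouble G :=
  (Nat.card G : ℂ)⁻¹ • ∑ h : G, bas 1 h

theorem isNormalizedIntegral_integral (G : Type u) [Group G] [Finite G] :
    IsNormalizedIntegral (integral G) := by
  refine ⟨fun x => ⟨?_, ?_⟩, ?_⟩
  · have : (LinearMap.mul ℂ (DrinfeldDouble G)).flip (integral G) =
        (Coalgebra.counit (R := ℂ) (A := DrinfeldDouble G)).smulRight (integral G) := by
      refine hom_ext fun a b => ?_
      simp only [LinearMap.flip_apply, LinearMap.mul_apply', LinearMap.smulRight_apply,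
        counit_bas, integral, mul_smul_comm, Finset.mul_sum, bas_mul_bas, mul_one,
        mul_inv_cancel]
      by_cases ha : a = 1
      · simp only [ha, if_true, one_smul]
        congr 1
        exact Fintype.sum_equiv (Equiv.mulLeft b) _ _ fun _ => rfl
      · simp [ha]
    exact congr($this x)
  · have : LinearMap.mul ℂ (DrinfeldDouble G) (integral G) =
        (Coalgebra.counit (R := ℂ) (A := DrinfeldDouble G)).smulRight (integral G) := by
      refine hom_ext fun a b => ?_
      have key : ∀ s : G, (1 = s * a * s⁻¹) = (a = 1) := by
        intro s
        refine propext ⟨fun h => ?_, fun h => by simp [h]⟩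
        have := congrArg (fun t => s⁻¹ * t * s) h
        simpa [mul_assoc] using this.symm
      simp only [LinearMap.mul_apply', LinearMap.smulRight_apply,
        counit_bas, integral, smul_mul_assoc, Finset.sum_mul, bas_mul_bas, key]
      by_cases ha : a = 1
      · simp only [ha, if_true, one_smul]
        congr 1
        exact Fintype.sum_equiv (Equiv.mulRight b) _ _ fun _ => rfl
      · simp [ha]
    exact congr($this x)
  · have : (Nat.card G : ℂ) ≠ 0 := Nat.cast_ne_zero.mpr Nat.card_pos.ne'
    simp only [integral, map_smul, map_sum, counit_bas, if_true, Finset.sum_const,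
      Finset.card_univ, nsmul_eq_mul, mul_one, smul_eq_mul]
    rw [← Nat.card_eq_fintype_card]
    exact inv_mul_cancel₀ this

end DrinfeldDouble

/-- `G` is an `FSZ_n`-group: the `n`-th Frobenius-Schur indicator of every irreducible
representation of `D(G)` is an integer. (Simple `D(G)`-modules are quotients of `D(G)`, hence
finite-dimensional and representable in the universe of `G`.) -/
def IsFSZ (n : ℕ) (G : Type u) [Group G] [Finite G] : Prop :=
  ∀ (V : Type u) [AddCommGroup V] [Module ℂ V] [Module (DrinfeldDouble G) V]
    [IsScalarTower ℂ (DrinfeldDouble G) V] [IsSimpleModule (DrinfeldDouble G) V],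
    ∃ k : ℤ, frobeniusSchurIndicator (DrinfeldDouble.integral G) n V = (k : ℂ)

section FSZPlus

/-- The set `G_n(u, g)` of all `a` with `(a u⁻¹)ⁿ = aⁿ = g`. -/
def rootSet {G : Type u} [Group G] (n : ℕ) (u g : G) : Set G :=
  {a | (a * u⁻¹) ^ n = a ^ n ∧ a ^ n = g}

theorem conj_mem_rootSet {G : Type u} [Group G] {n : ℕ} {u g g' k a : G}
    (hk : k ∈ Subgroup.centralizer {u, g}) (hg' : g' ∈ Subgroup.zpowers g)
    (ha : a ∈ rootSet n u g') : k * a * k⁻¹ ∈ rootSet n u g' := by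
  have hku : k * u⁻¹ * k⁻¹ = u⁻¹ := by
    have h : Commute u k := (Subgroup.mem_centralizer_iff.mp hk) u (by simp)
    rw [(h.symm.inv_right).eq, mul_inv_cancel_right]
  have hkg : k * g' * k⁻¹ = g' := by
    have h : Commute g k := (Subgroup.mem_centralizer_iff.mp hk) g (by simp)
    obtain ⟨z, rfl⟩ := Subgroup.mem_zpowers_iff.mp hg'
    rw [(h.symm.zpow_right z).eq, mul_inv_cancel_right]
  obtain ⟨h1, h2⟩ := ha
  have h3 : k * a * k⁻¹ * u⁻¹ = k * (a * u⁻¹) * k⁻¹ := by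
    conv_lhs => rw [← hku]
    simp [mul_assoc]
  refine ⟨?_, ?_⟩
  · rw [h3, conj_pow, conj_pow, h1]
  · rw [conj_pow, h2, hkg]

/-- For `g'` a power of `g`, the group `C_G(u, g)` acts on `G_n(u, g')` by conjugation. -/
@[reducible]
def conjAction {G : Type u} [Group G] (n : ℕ) (u g : G) {g' : G}
    (hg' : g' ∈ Subgroup.zpowers g) :
    MulAction (Subgroup.centralizer {u, g}) (rootSet n u g') where
  smul k a := ⟨(k : G) * a * (k : G)⁻¹, conj_mem_rootSet k.2 hg' a.2⟩
  one_smul a := Subtype.ext (by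
    change (1 : G) * a * (1 : G)⁻¹ = a
    simp)
  mul_smul k l a := Subtype.ext (by
    change ((k : G) * l) * a * ((k : G) * l)⁻¹ = k * (l * a * (l : G)⁻¹) * (k : G)⁻¹
    simp [mul_assoc])

/-- For `g'` a power of `g`, the permutation module over `ℂ` of `C_G(u, g)` afforded by
`G_n(u, g')`. -/
def permRep {G : Type u} [Group G] (n : ℕ) (u g : G) {g' : G}
    (hg' : g' ∈ Subgroup.zpowers g) :
    Representation ℂ (Subgroup.centralizer {u, g}) (MonoidAlgebra ℂ (rootSet n u g')) :=
  letI := conjAction n u g hg'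
  Representation.ofMulAction ℂ (Subgroup.centralizer {u, g}) (rootSet n u g')

/-- `G` is an `FSZ⁺_n`-group: for all commuting `u, g` and all integers `m` coprime to `|G|`, the
sets `G_n(u, g)` and `G_n(u, g ^ m)` afford isomorphic permutation modules for `C_G(u, g)`. -/
def IsFSZPlus (n : ℕ) (G : Type u) [Group G] [Finite G] : Prop :=
  ∀ u g : G, Commute u g → ∀ m : ℤ, Int.gcd m (Nat.card G) = 1 →
    Nonempty ((permRep n u g (Subgroup.mem_zpowers g)).Equiv
      (permRep n u g (Subgroup.zpow_mem_zpowers g m)))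

end FSZPlus

end

/-!
The indicator `ν_n(V)` equals `|G|⁻¹` times the value of the character of `V` at the central
element `z₁` of `D(G)`, where `z_m = ∑ |G_n(u, g)| e_u ⋈ g ^ m`. For `m` coprime to `|G|`, the
Galois automorphism `ζ ↦ ζ ^ m` of the cyclotomic field carries the character value at `z₁` to the
one at `z_m`. As indicators are algebraic integers, `ν_n(V)` is an integer exactly when these
values agree for all `m`. Irreducible characters separate central elements of the semisimple
algebra `D(G)`, so `G` is an `FSZ_n`-group if and only if `|G_n(u, g ^ m)| = |G_n(u, g)|` for all
`u`, `g` and all `m` coprime to `|G|`.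

Permutation modules over `ℂ` are determined by their characters, which count fixed points, and the
fixed points of `x` on `G_n(u, g)` are the set `G_n(u, g)` formed in the centralizer of `x`. Hence
`G` is an `FSZ⁺_n`-group if and only if the centralizers of all `x`, including `x = 1`, are
`FSZ_n`-groups. The case `x = 1` follows from the others because `G_n(u, g)` lies in the
centralizer of `g`.
-/

noncomputable section

open scoped TensorProduct

section Traces
open Polynomial

variable {K V : Type*} [Field K] [AddCommGroup V] [Module K V] {A : Module.End K V} {N : ℕ}

theorem isSemisimple_of_pow_succ_eq_self [FiniteDimensional K V] (hN : (N : K) ≠ 0)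
    (hA : A ^ (N + 1) = A) : A.IsSemisimple := by
  have hN₀ : N ≠ 0 := by rintro rfl; simp at hN
  refine Module.End.isSemisimple_of_squarefree_aeval_eq_zero (p := X * (X ^ N - 1)) ?_ ?_
  · have hcop : IsCoprime (X : K[X]) (X ^ N - 1) :=
      ⟨X ^ (N - 1), -1, by rw [← pow_succ, Nat.sub_one_add_one hN₀]; ring⟩
    exact (separable_X.mul (X_pow_sub_one_separable_iff.2 hN) hcop).squarefree
  · simp [mul_sub, ← pow_succ', hA]

theorem pow_eq_one_of_hasEigenvalue_of_pow_succ_eq_self (hA : A ^ (N + 1) = A) {μ : K}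
    (hμ : A.HasEigenvalue μ) (hμ₀ : μ ≠ 0) : μ ^ N = 1 := by
  obtain ⟨v, hv⟩ := hμ.exists_hasEigenvector
  have h := hv.pow_apply (N + 1)
  rw [hA, hv.apply_eq_smul] at h
  have h' := smul_left_injective K hv.2 h
  simpa [pow_succ, hμ₀] using h'

variable [FiniteDimensional K V] [IsAlgClosed K]

theorem trace_pow_eq_sum_finrank_eigenspace (hA : A.IsSemisimple) {s : Finset K}
    (hs : ∀ μ, A.HasEigenvalue μ → μ ∈ s) (m : ℕ) :
    LinearMap.trace K V (A ^ m) = ∑ μ ∈ s, (Module.finrank K (A.eigenspace μ) : K) * μ ^ m := by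
  classical
  have hint : DirectSum.IsInternal A.eigenspace :=
    DirectSum.isInternal_submodule_of_iSupIndep_of_iSup_eq_top A.eigenspaces_iSupIndep
      hA.iSup_eigenspace_eq_top
  have hfin := WellFoundedGT.finite_ne_bot_of_iSupIndep A.eigenspaces_iSupIndep
  have hmaps (μ : K) : Set.MapsTo (A ^ m) (A.eigenspace μ) (A.eigenspace μ) :=
    Module.End.mapsTo_genEigenspace_of_comm ((Commute.refl A).pow_right m) μ 1
  have hpow (μ : K) : (A ^ m).restrict (hmaps μ) = μ ^ m • LinearMap.id := by
    ext ⟨v, hv⟩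
    change (A ^ m) v = μ ^ m • v
    obtain rfl | hv₀ := eq_or_ne v 0
    · simp
    · exact Module.End.HasEigenvector.pow_apply ⟨hv, hv₀⟩ m
  calc LinearMap.trace K V (A ^ m)
      = ∑ μ ∈ hfin.toFinset, (Module.finrank K (A.eigenspace μ) : K) * μ ^ m := by
        rw [LinearMap.trace_eq_sum_trace_restrict' hint hfin hmaps]
        exact Finset.sum_congr rfl fun μ _ ↦ by simp [hpow, mul_comm]
    _ = _ := Finset.sum_subset (fun μ hμ ↦ hs μ (hfin.mem_toFinset.1 hμ)) fun μ _ hμ ↦ by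
        have hbot : A.eigenspace μ = ⊥ := not_not.1 (mt hfin.mem_toFinset.2 hμ)
        rw [hbot, finrank_bot, Nat.cast_zero, zero_mul]

theorem trace_pow_eq_sum_range_of_pow_succ_eq_self (hN : (N : K) ≠ 0) {ζ : K}
    (hζ : IsPrimitiveRoot ζ N) (hA : A ^ (N + 1) = A) {m : ℕ} (hm : m ≠ 0) :
    LinearMap.trace K V (A ^ m) =
      ∑ i ∈ Finset.range N, (Module.finrank K (A.eigenspace (ζ ^ i)) : K) * (ζ ^ m) ^ i := by
  classical
  have : NeZero N := ⟨by rintro rfl; simp at hN⟩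
  have hmem (μ : K) (hμ : A.HasEigenvalue μ) :
      μ ∈ insert 0 ((Finset.range N).image (ζ ^ ·)) := by
    obtain rfl | hμ₀ := eq_or_ne μ 0
    · exact Finset.mem_insert_self _ _
    · obtain ⟨i, hi, rfl⟩ := hζ.eq_pow_of_pow_eq_one
        (pow_eq_one_of_hasEigenvalue_of_pow_succ_eq_self hA hμ hμ₀)
      exact Finset.mem_insert_of_mem (Finset.mem_image_of_mem _ (Finset.mem_range.2 hi))
  have hinj : Set.InjOn (ζ ^ ·) (Finset.range N : Set ℕ) := fun i hi j hj h ↦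
    hζ.pow_inj (Finset.mem_range.1 hi) (Finset.mem_range.1 hj) h
  rw [trace_pow_eq_sum_finrank_eigenspace (isSemisimple_of_pow_succ_eq_self hN hA) hmem,
    Finset.sum_insert_of_eq_zero_if_notMem (by simp [hm]), Finset.sum_image hinj]
  simp only [← pow_mul, mul_comm]

theorem exists_forall_trace_pow_eq_aeval (hN : (N : K) ≠ 0) {ζ : K}
    (hζ : IsPrimitiveRoot ζ N) (hA : A ^ (N + 1) = A) :
    ∃ q : ℤ[X], ∀ m ≠ 0, LinearMap.trace K V (A ^ m) = aeval (ζ ^ m) q :=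
  ⟨∑ i ∈ Finset.range N, C (Module.finrank K (A.eigenspace (ζ ^ i)) : ℤ) * X ^ i, fun m hm ↦ by
    simp [trace_pow_eq_sum_range_of_pow_succ_eq_self hN hζ hA hm]⟩

theorem isIntegral_trace_of_pow_succ_eq_self (hN : (N : K) ≠ 0) (hA : A ^ (N + 1) = A) :
    IsIntegral ℤ (LinearMap.trace K V A) := by
  have : NeZero (N : K) := ⟨hN⟩
  obtain ⟨ζ, hζ⟩ := HasEnoughRootsOfUnity.exists_primitiveRoot K N
  rw [← pow_one A, trace_pow_eq_sum_range_of_pow_succ_eq_self hN hζ hA one_ne_zero]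
  have hN₀ : 0 < N := Nat.pos_of_ne_zero (by rintro rfl; simp at hN)
  exact IsIntegral.sum _ fun i _ ↦
    (isIntegral_natCast _).mul (((hζ.isIntegral hN₀).pow 1).pow i)

end Traces

section IntegerValues
open Polynomial

variable {K : Type*} [Field K] [CharZero K] {N : ℕ} {ζ : K}

theorem aeval_eq_of_isPrimitiveRoot_of_aeval_eq_intCast (hN : 0 < N) (hζ : IsPrimitiveRoot ζ N)
    {q : ℤ[X]} {k : ℤ} (hk : aeval ζ q = k) {μ : K} (hμ : IsPrimitiveRoot μ N) :
    aeval μ q = k := by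
  have hdvd : cyclotomic N ℤ ∣ q - C k := by
    rw [cyclotomic_eq_minpoly hζ hN]
    exact minpoly.isIntegrallyClosed_dvd (hζ.isIntegral hN) (by simp [hk])
  have hroot : aeval μ (cyclotomic N ℤ) = 0 := by
    rw [cyclotomic_eq_minpoly hμ hN, minpoly.aeval]
  simpa [sub_eq_zero] using aeval_eq_zero_of_dvd_aeval_eq_zero hdvd hroot

theorem exists_intCast_eq_aeval_iff (hN : 0 < N) (hζ : IsPrimitiveRoot ζ N) (q : ℤ[X]) :
    (∃ k : ℤ, aeval ζ q = k) ↔ ∀ μ : K, IsPrimitiveRoot μ N → aeval μ q = aeval ζ q := by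
  refine ⟨fun ⟨k, hk⟩ μ hμ ↦
    (aeval_eq_of_isPrimitiveRoot_of_aeval_eq_intCast hN hζ hk hμ).trans hk.symm, fun h ↦ ?_⟩
  let φ := Int.castRingHom K
  have hdvd : cyclotomic N K ∣ q.map φ - C (aeval ζ q) := by
    rw [cyclotomic_eq_prod_X_sub_primitiveRoots hζ]
    refine Finset.prod_dvd_of_coprime (fun μ _ ν _ hμν ↦ ?_) fun μ hμ ↦ ?_
    · exact isCoprime_X_sub_C_of_isUnit_sub (sub_ne_zero.2 hμν).isUnit
    · rw [dvd_iff_isRoot, IsRoot, eval_sub, eval_C, sub_eq_zero, eval_map,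
        ← h μ (isPrimitiveRoot_of_mem_primitiveRoots hμ)]
      rfl
  have hdeg : (C (aeval ζ q)).degree < (cyclotomic N K).degree :=
    degree_C_le.trans_lt (degree_cyclotomic_pos N K hN)
  have hmod : (q %ₘ cyclotomic N ℤ).map φ = C (aeval ζ q) := by
    rw [map_modByMonic _ (cyclotomic.monic N ℤ), map_cyclotomic_int,
      modByMonic_eq_of_dvd_sub (cyclotomic.monic N K) hdvd,
      (modByMonic_eq_self_iff (cyclotomic.monic N K)).2 hdeg]
  exact ⟨(q %ₘ cyclotomic N ℤ).coeff 0, by simpa using (congrArg (coeff · 0) hmod).symm⟩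

theorem exists_eq_intCast_of_isIntegral_of_intCast_mul_eq {K : Type*} [Field K] [CharZero K]
    {x : K} (hx : IsIntegral ℤ x) {d k : ℤ} (hd : d ≠ 0) (h : d * x = k) : ∃ l : ℤ, x = l := by
  have hd' : (d : K) ≠ 0 := Int.cast_ne_zero.2 hd
  have hrat : x = algebraMap ℚ K (k / d) := by
    rw [map_div₀, map_intCast, map_intCast, ← h, mul_div_cancel_left₀ x hd']
  rw [hrat, isIntegral_algebraMap_iff (algebraMap ℚ K).injective,
    IsIntegrallyClosed.isIntegral_iff] at hx
  obtain ⟨l, hl⟩ := hx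
  exact ⟨l, by rw [hrat, ← hl]; simp⟩

/-- `m` is allowed to exceed `N` so that it can be chosen nonzero also when `N = 1`. -/
theorem isPrimitiveRoot_iff_exists_pow_eq {R : Type*} [CommRing R] [IsDomain R] {N : ℕ}
    (hN : 0 < N) {ζ : R} (hζ : IsPrimitiveRoot ζ N) {μ : R} :
    IsPrimitiveRoot μ N ↔ ∃ m ≠ 0, N.Coprime m ∧ ζ ^ m = μ := by
  have : NeZero N := ⟨hN.ne'⟩
  constructor
  · intro hμ
    obtain ⟨i, -, hi, rfl⟩ := hζ.isPrimitiveRoot_iff.1 hμ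
    exact ⟨i + N, by lia, by simpa using hi.symm, by rw [pow_add, hζ.pow_eq_one, mul_one]⟩
  · rintro ⟨m, -, hm, rfl⟩
    exact hζ.pow_of_coprime m hm.symm

end IntegerValues

section CyclicRotation

theorem prod_ofFn_comp_finRotate_eq_one_iff {G : Type*} [Group G] {n : ℕ} (a : Fin n → G) :
    (List.ofFn (a ∘ finRotate n)).prod = 1 ↔ (List.ofFn a).prod = 1 := by
  cases n with
  | zero => simp
  | succ n =>
    rw [List.ofFn_succ', List.prod_concat, List.ofFn_succ, List.prod_cons, mul_eq_one_comm]
    simp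

theorem prod_ofFn_conj {G : Type*} [Group G] {n : ℕ} (a : Fin n → G) (h : G) :
    (List.ofFn fun k ↦ h * a k * h⁻¹).prod = h * (List.ofFn a).prod * h⁻¹ := by
  simpa [Function.comp_def] using (map_list_prod (MulAut.conj h) (List.ofFn a)).symm

theorem finRotate_pow_self (n : ℕ) : finRotate n ^ n = 1 := by
  match n with
  | 0 | 1 => exact Subsingleton.elim _ _
  | n + 2 =>
    have horder : orderOf (finRotate (n + 2)) = n + 2 := by
      rw [isCycle_finRotate.orderOf, support_finRotate, Finset.card_univ, Fintype.card_fin]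
    rw [← orderOf_dvd_iff_pow_eq_one, horder]

variable {R ι : Type*} [CommSemiring R] [Fintype ι] [DecidableEq ι]

theorem prod_ofFn_apply_eq_sum {n : ℕ} (M : Fin (n + 1) → Matrix ι ι R) (x y : ι) :
    (List.ofFn M).prod x y =
      ∑ p : Fin n → ι, ∏ k, M k (Fin.cons (α := fun _ ↦ ι) x p k)
        (Fin.snoc (α := fun _ ↦ ι) p y k) := by
  induction n generalizing x with
  | zero => simp [Fin.snoc]
  | succ n ih =>
    rw [List.ofFn_succ, List.prod_cons, Matrix.mul_apply,
      ← (Fin.consEquiv fun _ ↦ ι).sum_comp, Fintype.sum_prod_type]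
    refine Finset.sum_congr rfl fun z _ ↦ ?_
    rw [ih, Finset.mul_sum]
    refine Finset.sum_congr rfl fun p _ ↦ ?_
    rw [Fin.prod_univ_succ (n := n + 1)]
    simp [Fin.consEquiv, ← Fin.cons_snoc_eq_snoc_cons]

theorem trace_prod_ofFn_eq_sum {n : ℕ} (M : Fin (n + 1) → Matrix ι ι R) :
    (List.ofFn M).prod.trace =
      ∑ p : Fin (n + 1) → ι, ∏ k, M k (p k) (p (finRotate (n + 1) k)) := by
  simp only [Matrix.trace, Matrix.diag, prod_ofFn_apply_eq_sum]
  rw [← (Fin.consEquiv fun _ ↦ ι).sum_comp, Fintype.sum_prod_type]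
  refine Finset.sum_congr rfl fun x _ ↦ Finset.sum_congr rfl fun p _ ↦
    Finset.prod_congr rfl fun k _ ↦ congrArg _ ?_
  induction k using Fin.lastCases with
  | last => simp [Fin.consEquiv]
  | cast k => simp [Fin.consEquiv]

end CyclicRotation

section TensorRotation

variable (K V : Type*) [CommSemiring K] [AddCommMonoid V] [Module K V]

/-- The operator `v₀ ⊗ ⋯ ⊗ vₙ₋₁ ↦ v₁ ⊗ ⋯ ⊗ vₙ₋₁ ⊗ v₀` on `V^{⊗n}`. -/
def tensorRotation (n : ℕ) : Module.End K (⨂[K] _ : Fin n, V) :=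
  (PiTensorProduct.reindex K (fun _ ↦ V) (finRotate n).symm).toLinearMap

variable {K V}

@[simp]
theorem tensorRotation_tprod {n : ℕ} (v : Fin n → V) :
    tensorRotation K V n (PiTensorProduct.tprod K v) = PiTensorProduct.tprod K (v ∘ finRotate n) :=
  PiTensorProduct.reindex_tprod _ _

theorem tensorRotation_pow_self (n : ℕ) : tensorRotation K V n ^ n = 1 := by
  have hpow (m : ℕ) (v : Fin n → V) : (tensorRotation K V n ^ m) (PiTensorProduct.tprod K v) =
      PiTensorProduct.tprod K (v ∘ (finRotate n ^ m : Equiv.Perm (Fin n))) := by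
    induction m with
    | zero => rfl
    | succ m ih => rw [pow_succ', Module.End.mul_apply, ih, tensorRotation_tprod, pow_succ]; rfl
  ext v
  simp [hpow, finRotate_pow_self]

theorem tensorRotation_mul_map {n : ℕ} (A : Fin n → Module.End K V) :
    tensorRotation K V n * PiTensorProduct.map A =
      PiTensorProduct.map (A ∘ finRotate n) * tensorRotation K V n := by
  ext v
  simp only [LinearMap.compMultilinearMap_apply, Module.End.mul_apply, PiTensorProduct.map_tprod,
    tensorRotation_tprod]
  rfl

theorem trace_map_mul_tensorRotation [Module.Free K V] [Module.Finite K V] {n : ℕ}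
    (A : Fin (n + 1) → Module.End K V) :
    LinearMap.trace K _ (PiTensorProduct.map A * tensorRotation K V (n + 1)) =
      LinearMap.trace K V (List.ofFn A).prod := by
  classical
  let b := Module.Free.chooseBasis K V
  let β := Basis.piTensorProduct fun _ : Fin (n + 1) ↦ b
  have hdiag (p) : LinearMap.toMatrix β β (PiTensorProduct.map A * tensorRotation K V (n + 1)) p p =
      ∏ k, LinearMap.toMatrix b b (A k) (p k) (p (finRotate (n + 1) k)) := by
    simp [β, LinearMap.toMatrix_apply]
  have hprod : LinearMap.toMatrix b b (List.ofFn A).prod =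
      (List.ofFn fun k ↦ LinearMap.toMatrix b b (A k)).prod := by
    change LinearMap.toMatrixAlgEquiv b _ = _
    rw [map_list_prod, List.map_ofFn]
    rfl
  rw [LinearMap.trace_eq_matrix_trace K β, LinearMap.trace_eq_matrix_trace K b, hprod,
    trace_prod_ofFn_eq_sum]
  exact Finset.sum_congr rfl fun p _ ↦ hdiag p

end TensorRotation

theorem isIdempotentElem_average {G K A : Type*} [Group G] [Fintype G] [Field K] [Ring A]
    [Algebra K A] (hG : (Nat.card G : K) ≠ 0) (T : G →ₙ* A) :
    IsIdempotentElem ((Nat.card G : K)⁻¹ • ∑ h, T h) := by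
  have hsq : (∑ h, T h) * ∑ h, T h = (Nat.card G : K) • ∑ h, T h := by
    have habsorb (h : G) : T h * ∑ k, T k = ∑ k, T k := by
      simp only [Finset.mul_sum, ← map_mul]
      exact Equiv.sum_comp (Equiv.mulLeft h) T
    simp only [Finset.sum_mul, habsorb, Finset.sum_const, Finset.card_univ,
      Nat.card_eq_fintype_card, Nat.cast_smul_eq_nsmul]
  rw [IsIdempotentElem, smul_mul_smul_comm, hsq, smul_smul, mul_assoc, inv_mul_cancel₀ hG, mul_one]

section ModuleCharacter

/-- The character `a ↦ tr(a | V)` of the `A`-module `V`, as a linear form on the `K`-algebra `A`. It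
is identically zero if `V` is infinite-dimensional over `K`. -/
def moduleCharacter (K A V : Type*) [Field K] [Ring A] [Algebra K A] [AddCommGroup V] [Module K V]
    [Module A V] [IsScalarTower K A V] : A →ₗ[K] K :=
  LinearMap.trace K V ∘ₗ (Algebra.lsmul K K V).toLinearMap

variable {K A : Type*} [Field K] [Ring A] [Algebra K A]

theorem smul_eq_zero_of_moduleCharacter_eq_zero [IsAlgClosed K] [CharZero K] {V : Type*}
    [AddCommGroup V] [Module K V] [Module A V] [IsScalarTower K A V] [IsSimpleModule A V]
    [FiniteDimensional K V] {z : A} (hz : z ∈ Subalgebra.center K A)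
    (hχ : moduleCharacter K A V z = 0) (v : V) : z • v = 0 := by
  let f : Module.End A V :=
    { toFun := (z • ·)
      map_add' := smul_add z
      map_smul' := fun x w ↦ by
        rw [RingHom.id_apply, ← mul_smul, ← Subalgebra.mem_center_iff.1 hz x, mul_smul] }
  obtain ⟨c, hc⟩ := (IsSimpleModule.algebraMap_end_bijective_of_isAlgClosed K).2 f
  have hscalar : Algebra.lsmul K K V z = c • LinearMap.id :=
    LinearMap.ext fun w ↦ congr($hc.symm w)
  have : Nontrivial V := IsSimpleModule.nontrivial A V
  have hfinrank : (Module.finrank K V : K) ≠ 0 := Nat.cast_ne_zero.2 Module.finrank_pos.ne'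
  have hc₀ : c = 0 := by
    have htrace : LinearMap.trace K V (Algebra.lsmul K K V z) = 0 := hχ
    simpa [hscalar, hfinrank] using htrace
  simpa [hc₀] using congr($hscalar v)

theorem mem_jacobson_bot_of_moduleCharacter_eq_zero {A : Type u} [Ring A] [Algebra K A]
    [FiniteDimensional K A] [IsAlgClosed K] [CharZero K] {z : A}
    (hz : z ∈ Subalgebra.center K A)
    (hχ : ∀ (V : Type u) [AddCommGroup V] [Module K V] [Module A V] [IsScalarTower K A V]
      [IsSimpleModule A V], moduleCharacter K A V z = 0) :
    z ∈ (⊥ : Ideal A).jacobson := by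
  rw [Ideal.jacobson, Ideal.mem_sInf]
  rintro I ⟨-, hI⟩
  have : IsSimpleModule A (A ⧸ I) := isSimpleModule_iff_isCoatom.2 hI.out
  have : FiniteDimensional K (A ⧸ I) := Module.Finite.trans A _
  have hz₁ := smul_eq_zero_of_moduleCharacter_eq_zero hz (hχ (A ⧸ I)) (Submodule.Quotient.mk 1)
  rw [← Submodule.Quotient.mk_smul, smul_eq_mul, mul_one] at hz₁
  exact (Submodule.Quotient.mk_eq_zero I).1 hz₁

theorem moduleCharacter_self_mul_eq_zero_of_mem_jacobson_bot [FiniteDimensional K A] {z : A}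
    (hz : z ∈ (⊥ : Ideal A).jacobson) (y : A) : moduleCharacter K A A (y * z) = 0 := by
  have : IsArtinianRing A := IsArtinianRing.of_finite K A
  obtain ⟨k, hk⟩ := IsArtinianRing.isNilpotent_jacobson_bot (R := A)
  have hpow : (y * z) ^ k = 0 := by
    simpa [hk] using Ideal.pow_mem_pow (Ideal.mul_mem_left _ y hz) k
  have hnil : IsNilpotent (Algebra.lsmul K K A (y * z)) := ⟨k, by rw [← map_pow, hpow, map_zero]⟩
  exact (LinearMap.isNilpotent_trace_of_isNilpotent hnil).eq_zero

end ModuleCharacter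

theorem commute_of_commute_pow_of_coprime {G : Type*} [Group G] [Finite G] {m : ℕ}
    (hm : (Nat.card G).Coprime m) {u g : G} (h : Commute u (g ^ m)) : Commute u g := by
  have hconj : u * g * u⁻¹ = g :=
    (powCoprime hm).injective ((conj_pow ..).trans (mul_inv_eq_of_eq_mul h))
  exact eq_mul_of_mul_inv_eq hconj

section RootSet

variable {G : Type u} [Group G] {n : ℕ} {u g a : G}

theorem commute_of_mem_rootSet (ha : a ∈ rootSet n u g) : Commute u g := by
  obtain ⟨hau, rfl⟩ := ha
  have h : Commute (a * u⁻¹) (a ^ n) := hau ▸ Commute.self_pow _ n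
  simpa using h.inv_left.mul_left ((Commute.refl a).pow_right n)

theorem mem_rootSet_pow_iff : a ∈ rootSet n u (a ^ n) ↔ (a * u⁻¹) ^ n = a ^ n :=
  and_iff_left rfl

theorem conj_mem_rootSet_conj_iff (k : G) :
    k * a * k⁻¹ ∈ rootSet n (k * u * k⁻¹) (k * g * k⁻¹) ↔ a ∈ rootSet n u g := by
  have hau : k * a * k⁻¹ * (k * u * k⁻¹)⁻¹ = k * (a * u⁻¹) * k⁻¹ := by group
  simp only [rootSet, Set.mem_ofPred_eq, hau, conj_pow, mul_left_inj, mul_right_inj]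

end RootSet

namespace DrinfeldDouble

open scoped Classical

attribute [local instance] Fintype.ofFinite

variable {G : Type u}

/-- The vectors `e_g ⋈ h` as a basis of `D(G)`, used to compare central elements by coordinates. -/
def basis (G : Type u) : Module.Basis (G × G) ℂ (DrinfeldDouble G) := Finsupp.basisSingleOne

theorem basis_apply (p : G × G) : basis G p = bas p.1 p.2 := congrFun Finsupp.coe_basisSingleOne p

theorem basis_repr_bas (u g : G) : (basis G).repr (bas u g) = Finsupp.single (u, g) 1 := by
  rw [← basis_apply (u, g), Module.Basis.repr_self]

variable [Group G]

theorem bas_mul_bas_conj (b h k : G) :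
    bas b h * bas (h⁻¹ * b * h) k = (bas b (h * k) : DrinfeldDouble G) := by
  rw [bas_mul_bas, if_pos (by group)]

theorem bas_conj_mul_bas {u g : G} (hug : Commute u g) (c k : G) :
    bas (k * u * k⁻¹) (k * g * k⁻¹) * bas c k = (bas c k * bas u g : DrinfeldDouble G) := by
  have hcond : k * u * k⁻¹ = k * g * k⁻¹ * c * (k * g * k⁻¹)⁻¹ ↔ c = k * u * k⁻¹ := by
    have hfix : k * g * k⁻¹ * (k * u * k⁻¹) * (k * g * k⁻¹)⁻¹ = k * u * k⁻¹ := by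
      rw [← (hug.conj k).eq, mul_inv_cancel_right]
    nth_rewrite 1 [← hfix]
    rw [mul_left_inj, mul_right_inj, eq_comm]
  rw [bas_mul_bas, bas_mul_bas, inv_mul_cancel_right]
  by_cases hc : c = k * u * k⁻¹
  · rw [if_pos hc, if_pos (hcond.2 hc), hc]
  · rw [if_neg hc, if_neg (mt hcond.1 hc)]

variable [Finite G]

theorem bas_pow {u g : G} (hug : Commute u g) {m : ℕ} (hm : m ≠ 0) :
    (bas u g : DrinfeldDouble G) ^ m = bas u (g ^ m) := by
  induction m, Nat.one_le_iff_ne_zero.2 hm using Nat.le_induction with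
  | base => simp
  | succ m _ ih =>
    rw [pow_succ, ih (by lia), bas_mul_bas, ← (hug.pow_right m).eq, mul_inv_cancel_right,
      if_pos rfl, pow_succ]

section SweedlerPower

theorem sweedlerPower_zero_bas (g h : G) :
    sweedlerPower (DrinfeldDouble G) 0 (bas g h) = if g = 1 then 1 else 0 := by
  simp [sweedlerPower, counit_bas, apply_ite (algebraMap ℂ (DrinfeldDouble G))]

theorem sweedlerPower_succ_bas (n : ℕ) (g h : G) :
    sweedlerPower (DrinfeldDouble G) (n + 1) (bas g h) =
      ∑ a : G, bas a h * sweedlerPower (DrinfeldDouble G) n (bas (a⁻¹ * g) h) := by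
  have hconv : sweedlerPower (DrinfeldDouble G) (n + 1) (bas g h) =
      LinearMap.mul' ℂ _ (TensorProduct.map LinearMap.id (sweedlerPower (DrinfeldDouble G) n)
        (Coalgebra.comul (bas g h))) := by
    rw [sweedlerPower, pow_succ']
    rfl
  simp [hconv, comul_bas]

theorem sweedlerPower_bas_eq_sum_prod (n : ℕ) (g h : G) :
    sweedlerPower (DrinfeldDouble G) n (bas g h) =
      ∑ a : Fin n → G with (List.ofFn a).prod = g, (List.ofFn fun k ↦ bas (a k) h).prod := by
  simp only [Finset.sum_filter]
  induction n generalizing g with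
  | zero => simp [sweedlerPower_zero_bas, eq_comm]
  | succ n ih =>
    rw [sweedlerPower_succ_bas, ← (Fin.consEquiv fun _ ↦ G).sum_comp, Fintype.sum_prod_type]
    simp only [ih, Finset.mul_sum, Fin.consEquiv, Equiv.coe_fn_mk, List.ofFn_succ, Fin.cons_zero,
      Fin.cons_succ, List.prod_cons, mul_ite, mul_zero, eq_inv_mul_iff_mul_eq]

theorem sweedlerPower_bas (n : ℕ) (g h : G) :
    sweedlerPower (DrinfeldDouble G) n (bas g h) =
      ∑ a : G with (a * h⁻¹) ^ n * h ^ n = g, bas a (h ^ n) := by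
  simp only [Finset.sum_filter]
  induction n generalizing g with
  | zero =>
    rw [sweedlerPower_zero_bas]
    simp only [pow_zero, mul_one, eq_comm (a := (1 : G))]
    split_ifs <;> simp [one_eq]
  | succ n ih =>
    rw [sweedlerPower_succ_bas]
    refine Finset.sum_congr rfl fun b _ ↦ ?_
    rw [ih, Finset.mul_sum, Finset.sum_eq_single (h⁻¹ * b * h)]
    · have hpow : (h⁻¹ * b * h * h⁻¹) ^ n * h ^ n = b⁻¹ * ((b * h⁻¹) ^ (n + 1) * h ^ (n + 1)) := by
        have hconj : h⁻¹ * b * h * h⁻¹ = b⁻¹ * (b * h⁻¹) * b⁻¹⁻¹ := by group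
        rw [hconj, conj_pow, pow_succ (b * h⁻¹), pow_succ' h]
        simp [mul_assoc]
      rw [mul_ite, mul_zero, bas_mul_bas_conj, hpow, ← pow_succ']
      simp only [mul_right_inj]
    · intro c _ hc
      have hb : b ≠ h * c * h⁻¹ := by rintro rfl; exact hc (by group)
      rw [mul_ite, mul_zero, bas_mul_bas, if_neg hb, ite_self]
    · simp

/-- `∑ e_u ⋈ h^{nm}`, over all `u` and `h` with `(h u⁻¹)^n = h^n`. For `m = 1` this is `|G|` times
the Sweedler power `Λ^[n]` of the integral; the other `m` are its Galois twists. -/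
def twistedPower (G : Type u) [Group G] [Finite G] (n m : ℕ) : DrinfeldDouble G :=
  ∑ p : G × G with p.2 ∈ rootSet n p.1 (p.2 ^ n), bas p.1 ((p.2 ^ n) ^ m)

theorem sweedlerPower_integral (n : ℕ) :
    sweedlerPower (DrinfeldDouble G) n (integral G) = (Nat.card G : ℂ)⁻¹ • twistedPower G n 1 := by
  have hcond (u h : G) : (u * h⁻¹) ^ n * h ^ n = 1 ↔ h ∈ rootSet n u (h ^ n) := by
    rw [mem_rootSet_pow_iff, mul_eq_one_iff_inv_eq, ← inv_pow, mul_inv_rev, inv_inv]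
  simp only [integral, twistedPower, map_smul, map_sum, sweedlerPower_bas, hcond,
    Finset.sum_filter, pow_one, Fintype.sum_prod_type_right]

theorem twistedPower_mem_center (n m : ℕ) :
    twistedPower G n m ∈ Subalgebra.center ℂ (DrinfeldDouble G) := by
  rw [Subalgebra.mem_center_iff]
  suffices h : LinearMap.mulRight ℂ (twistedPower G n m) =
      LinearMap.mulLeft ℂ (twistedPower G n m) from fun x ↦ congr($h x)
  refine hom_ext fun c k ↦ ?_
  simp only [LinearMap.mulRight_apply, LinearMap.mulLeft_apply, twistedPower, Finset.sum_mul,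
    Finset.mul_sum]
  let conj : G × G ≃ G × G := (MulAut.conj k).toEquiv.prodCongr (MulAut.conj k).toEquiv
  refine Finset.sum_equiv conj (fun p ↦ ?_) fun p hp ↦ ?_
  · simp [conj, conj_pow, conj_mem_rootSet_conj_iff]
  · have hp' := commute_of_mem_rootSet (Finset.mem_filter.1 hp).2
    simp [conj, conj_pow, bas_conj_mul_bas (hp'.pow_right m)]

theorem exists_forall_moduleCharacter_twistedPower_eq_aeval {ζ : ℂ}
    (hζ : IsPrimitiveRoot ζ (Nat.card G)) (V : Type*) [AddCommGroup V] [Module ℂ V]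
    [Module (DrinfeldDouble G) V] [IsScalarTower ℂ (DrinfeldDouble G) V] [FiniteDimensional ℂ V]
    (n : ℕ) :
    ∃ q : Polynomial ℤ, ∀ m ≠ 0,
      moduleCharacter ℂ _ V (twistedPower G n m) = Polynomial.aeval (ζ ^ m) q := by
  have hG : (Nat.card G : ℂ) ≠ 0 := Nat.cast_ne_zero.2 Nat.card_pos.ne'
  let ρ := Algebra.lsmul (A := DrinfeldDouble G) ℂ ℂ V
  have hterm (p : G × G) (hp : Commute p.1 (p.2 ^ n)) : ∃ q : Polynomial ℤ, ∀ m ≠ 0,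
      moduleCharacter ℂ _ V (bas p.1 ((p.2 ^ n) ^ m)) = Polynomial.aeval (ζ ^ m) q := by
    have hpow : ρ (bas p.1 (p.2 ^ n)) ^ (Nat.card G + 1) = ρ (bas p.1 (p.2 ^ n)) := by
      rw [← map_pow, bas_pow hp (Nat.succ_ne_zero _), pow_succ, pow_card_eq_one', one_mul]
    obtain ⟨q, hq⟩ := exists_forall_trace_pow_eq_aeval hG hζ hpow
    exact ⟨q, fun m hm ↦ by rw [← hq m hm, ← map_pow, bas_pow hp hm]; rfl⟩
  choose! q hq using hterm
  refine ⟨∑ p : G × G with p.2 ∈ rootSet n p.1 (p.2 ^ n), q p, fun m hm ↦ ?_⟩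
  rw [twistedPower, map_sum, map_sum]
  exact Finset.sum_congr rfl fun p hp ↦
    hq p (commute_of_mem_rootSet (Finset.mem_filter.1 hp).2) m hm

theorem frobeniusSchurIndicator_integral (n : ℕ) (V : Type*) [AddCommGroup V] [Module ℂ V]
    [Module (DrinfeldDouble G) V] [IsScalarTower ℂ (DrinfeldDouble G) V] :
    frobeniusSchurIndicator (integral G) n V =
      (Nat.card G : ℂ)⁻¹ * moduleCharacter ℂ _ V (twistedPower G n 1) := by
  rw [← smul_eq_mul, ← map_smul, ← sweedlerPower_integral]
  rfl

end SweedlerPower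

section TensorAction
variable {V : Type*} [AddCommGroup V] [Module ℂ V]
  [Module (DrinfeldDouble G) V] [IsScalarTower ℂ (DrinfeldDouble G) V]

variable (V) in
/-- The action of `e_1 ⋈ h` on `V^{⊗n}` through the `n`-fold comultiplication. -/
def tensorAction (n : ℕ) (h : G) : Module.End ℂ (⨂[ℂ] _ : Fin n, V) :=
  ∑ a : Fin n → G with (List.ofFn a).prod = 1,
    PiTensorProduct.map fun k ↦ Algebra.lsmul ℂ ℂ V (bas (a k) h)

theorem tensorAction_mul (n : ℕ) (h k : G) :
    tensorAction V n h * tensorAction V n k = tensorAction V n (h * k) := by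
  simp only [tensorAction, Finset.sum_mul_sum, ← PiTensorProduct.map_mul, ← map_mul]
  refine Finset.sum_congr rfl fun a ha ↦ ?_
  have hconj : (List.ofFn fun i ↦ h⁻¹ * a i * h).prod = 1 := by
    have h₁ := prod_ofFn_conj a h⁻¹
    rw [(Finset.mem_filter.1 ha).2] at h₁
    simpa using h₁
  rw [Finset.sum_eq_single_of_mem (fun i ↦ h⁻¹ * a i * h) (by simpa using hconj)]
  · simp only [bas_mul_bas_conj]
  · intro b _ hb
    obtain ⟨i, hi⟩ : ∃ i, a i ≠ h * b i * h⁻¹ := by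
      by_contra! hab
      exact hb (funext fun i ↦ by rw [hab]; group)
    refine (PiTensorProduct.mapMultilinear ℂ _ _).map_coord_zero i ?_
    rw [bas_mul_bas, if_neg hi, map_zero]

theorem commute_tensorAction_tensorRotation (n : ℕ) (h : G) :
    Commute (tensorAction V n h) (tensorRotation ℂ V n) := by
  symm
  rw [Commute, SemiconjBy, tensorAction, Finset.mul_sum, Finset.sum_mul]
  refine Finset.sum_equiv ((finRotate n).symm.arrowCongr (Equiv.refl G)) (fun a ↦ ?_) fun a _ ↦ ?_
  · simp only [Finset.mem_filter_univ]
    exact (prod_ofFn_comp_finRotate_eq_one_iff a).symm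
  · exact tensorRotation_mul_map _

theorem trace_tensorAction_mul_tensorRotation [FiniteDimensional ℂ V] (n : ℕ) (h : G) :
    LinearMap.trace ℂ _ (tensorAction V (n + 1) h * tensorRotation ℂ V (n + 1)) =
      moduleCharacter ℂ _ V (sweedlerPower (DrinfeldDouble G) (n + 1) (bas 1 h)) := by
  simp only [tensorAction, Finset.sum_mul, map_sum, sweedlerPower_bas_eq_sum_prod,
    trace_map_mul_tensorRotation]
  refine Finset.sum_congr rfl fun a _ ↦ ?_
  have hprod := map_list_prod (Algebra.lsmul (A := DrinfeldDouble G) ℂ ℂ V)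
    (List.ofFn fun k ↦ bas (a k) h)
  rw [List.map_ofFn] at hprod
  exact congrArg (LinearMap.trace ℂ V) hprod.symm

/-- The indicator is the trace of `P R` on `V^{⊗n}`, where the idempotent `P` is the action
of the integral and `R` is the rotation. These commute and `R ^ n = 1`, so the eigenvalues of `P R`
are among `0` and the `n`-th roots of unity. -/
theorem isIntegral_frobeniusSchurIndicator [FiniteDimensional ℂ V] {n : ℕ} (hn : 0 < n) :
    IsIntegral ℤ (frobeniusSchurIndicator (integral G) n V) := by
  obtain ⟨n, rfl⟩ := Nat.exists_eq_succ_of_ne_zero hn.ne'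
  let R := tensorRotation ℂ V (n + 1)
  let T : G →ₙ* Module.End ℂ (⨂[ℂ] _ : Fin (n + 1), V) :=
    ⟨tensorAction V (n + 1), fun h k ↦ (tensorAction_mul _ h k).symm⟩
  let P := (Nat.card G : ℂ)⁻¹ • ∑ h, T h
  have hP : IsIdempotentElem P :=
    isIdempotentElem_average (Nat.cast_ne_zero.2 Nat.card_pos.ne') T
  have hPR : Commute P R := (Commute.sum_left _ _ _ fun h _ ↦
    commute_tensorAction_tensorRotation _ h).smul_left _
  have hpow : (P * R) ^ (n + 1 + 1) = P * R := by
    rw [hPR.mul_pow, hP.pow_succ_eq, pow_succ R, tensorRotation_pow_self, one_mul]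
  have htrace : LinearMap.trace ℂ _ (P * R) = frobeniusSchurIndicator (integral G) (n + 1) V := by
    change _ = moduleCharacter ℂ _ V (sweedlerPower _ _ (integral G))
    simp only [P, integral, smul_mul_assoc, Finset.sum_mul, map_smul, map_sum,
      ← trace_tensorAction_mul_tensorRotation]
    rfl
  rw [Nat.succ_eq_add_one, ← htrace]
  exact isIntegral_trace_of_pow_succ_eq_self (Nat.cast_ne_zero.2 hn.ne') hpow

end TensorAction

section Criterion

instance : Module.Finite ℂ (DrinfeldDouble G) :=
  inferInstanceAs (Module.Finite ℂ ((G × G) →₀ ℂ))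

theorem moduleCharacter_self_bas (u g : G) :
    moduleCharacter ℂ _ (DrinfeldDouble G) (bas u g) = if g = 1 then (Nat.card G : ℂ) else 0 := by
  have hdiag (p : G × G) : (basis G).repr (bas u g * bas p.1 p.2) p =
      if p.1 = u then if g = 1 then 1 else 0 else 0 := by
    rw [bas_mul_bas]
    by_cases hg : g = 1
    · by_cases hu : u = p.1 <;> simp [hg, hu, eq_comm (a := p.1), basis_repr_bas]
    · simp only [hg, if_false, ite_self]
      split_ifs
      · simp [basis_repr_bas, Prod.ext_iff, hg]
      · simp
  calc moduleCharacter ℂ _ (DrinfeldDouble G) (bas u g)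
      = ∑ p, (basis G).repr (bas u g * bas p.1 p.2) p := by
        rw [moduleCharacter, LinearMap.comp_apply, LinearMap.trace_eq_matrix_trace ℂ (basis G)]
        simp [Matrix.trace, LinearMap.toMatrix_apply, basis_apply]
    _ = _ := by
      simp only [hdiag, Fintype.sum_prod_type_right, Finset.sum_ite_eq', Finset.mem_univ, if_true]
      simp [Nat.card_eq_fintype_card]

theorem moduleCharacter_self_bas_mul (u g : G) (z : DrinfeldDouble G) :
    moduleCharacter ℂ _ (DrinfeldDouble G) (bas (g⁻¹ * u * g) g⁻¹ * z) =
      Nat.card G * (basis G).repr z (u, g) := by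
  suffices h : moduleCharacter ℂ _ (DrinfeldDouble G) ∘ₗ
      LinearMap.mulLeft ℂ (bas (g⁻¹ * u * g) g⁻¹) = (Nat.card G : ℂ) • (basis G).coord (u, g) from
    congr($h z)
  refine hom_ext fun a b ↦ ?_
  have hcond : g⁻¹ * u * g = g⁻¹ * a * g⁻¹⁻¹ ↔ a = u := by
    rw [inv_inv, mul_left_inj, mul_right_inj, eq_comm]
  have hcond' : g⁻¹ * b = 1 ↔ b = g := by rw [inv_mul_eq_one, eq_comm]
  simp only [LinearMap.comp_apply, LinearMap.mulLeft_apply, bas_mul_bas, hcond,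
    LinearMap.smul_apply, Module.Basis.coord_apply, basis_repr_bas, map_zero,
    apply_ite (moduleCharacter ℂ (DrinfeldDouble G) (DrinfeldDouble G)),
    moduleCharacter_self_bas, hcond', Finsupp.single_apply, Prod.mk.injEq, ite_and, smul_eq_mul,
    mul_ite, mul_one, mul_zero]

/-- The trace form of the regular representation pairs `e_u ⋈ g` with `e_{g⁻¹ug} ⋈ g⁻¹`, so it is
nondegenerate, while the Jacobson radical lies in its kernel. -/
theorem eq_zero_of_mem_jacobson_bot {z : DrinfeldDouble G}
    (hz : z ∈ (⊥ : Ideal (DrinfeldDouble G)).jacobson) : z = 0 := by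
  refine (basis G).ext_elem fun p ↦ ?_
  have h := moduleCharacter_self_mul_eq_zero_of_mem_jacobson_bot (K := ℂ) hz
    (bas (p.2⁻¹ * p.1 * p.2) p.2⁻¹)
  rw [moduleCharacter_self_bas_mul] at h
  simpa [Nat.card_pos.ne'] using h

theorem basis_repr_twistedPower (n : ℕ) {m : ℕ} (hm : (Nat.card G).Coprime m) (u g : G) :
    (basis G).repr (twistedPower G n m) (u, g ^ m) = (rootSet n u g).ncard := by
  have hinj : Function.Injective (fun x : G ↦ x ^ m) := (powCoprime hm).injective
  have hcond (p : G × G) : p.2 ∈ rootSet n p.1 (p.2 ^ n) ∧ (p.1, (p.2 ^ n) ^ m) = (u, g ^ m) ↔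
      p.1 = u ∧ p.2 ∈ rootSet n u g := by
    rw [Prod.mk.injEq, hinj.eq_iff]
    constructor
    · rintro ⟨hp, rfl, rfl⟩
      exact ⟨rfl, hp⟩
    · rintro ⟨rfl, hp⟩
      exact ⟨hp.2 ▸ hp, rfl, hp.2⟩
  simp only [twistedPower, map_sum, Finsupp.finsetSum_apply, basis_repr_bas, Finsupp.single_apply,
    Finset.sum_boole, Finset.filter_filter, hcond]
  rw [← Set.ncard_coe_finset, Nat.cast_inj]
  refine (Set.ncard_congr (fun a _ ↦ (u, a)) (fun a ha ↦ ?_)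
    (fun a b _ _ h ↦ (Prod.mk.inj h).2) fun p hp ↦ ?_).symm
  · simpa using ha
  · obtain ⟨rfl, ha⟩ : p.1 = u ∧ p.2 ∈ rootSet n u g := by simpa using hp
    exact ⟨p.2, ha, rfl⟩

theorem twistedPower_eq_twistedPower_one_iff (n : ℕ) {m : ℕ} (hm : (Nat.card G).Coprime m) :
    twistedPower G n m = twistedPower G n 1 ↔
      ∀ u g : G, (rootSet n u (g ^ m)).ncard = (rootSet n u g).ncard := by
  have hsurj : Function.Surjective fun p : G × G ↦ (p.1, p.2 ^ m) :=
    Function.surjective_id.prodMap (powCoprime hm).surjective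
  have hone (u g : G) : (basis G).repr (twistedPower G n 1) (u, g) = (rootSet n u g).ncard := by
    simpa using basis_repr_twistedPower n (Nat.coprime_one_right (Nat.card G)) u g
  rw [(basis G).ext_elem_iff, hsurj.forall, Prod.forall]
  simp only [basis_repr_twistedPower n hm, hone, Nat.cast_inj, eq_comm]

theorem exists_intCast_eq_frobeniusSchurIndicator_iff {n : ℕ} (hn : 0 < n) (V : Type*)
    [AddCommGroup V] [Module ℂ V] [Module (DrinfeldDouble G) V]
    [IsScalarTower ℂ (DrinfeldDouble G) V] [FiniteDimensional ℂ V] :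
    (∃ k : ℤ, frobeniusSchurIndicator (integral G) n V = k) ↔
      ∀ m ≠ 0, (Nat.card G).Coprime m → moduleCharacter ℂ _ V (twistedPower G n m) =
        moduleCharacter ℂ _ V (twistedPower G n 1) := by
  have hG : (Nat.card G : ℂ) ≠ 0 := Nat.cast_ne_zero.2 Nat.card_pos.ne'
  have hζ := Complex.isPrimitiveRoot_exp (Nat.card G) Nat.card_pos.ne'
  obtain ⟨q, hq⟩ := exists_forall_moduleCharacter_twistedPower_eq_aeval hζ V n
  set ζ := Complex.exp (2 * Real.pi * Complex.I / Nat.card G)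
  have hone : moduleCharacter ℂ _ V (twistedPower G n 1) = Polynomial.aeval ζ q := by
    rw [hq 1 one_ne_zero, pow_one]
  have hν : ((Nat.card G : ℤ) : ℂ) * frobeniusSchurIndicator (integral G) n V =
      Polynomial.aeval ζ q := by
    rw [frobeniusSchurIndicator_integral, hone, Int.cast_natCast, mul_inv_cancel_left₀ hG]
  have hdenom : (∃ k : ℤ, frobeniusSchurIndicator (integral G) n V = k) ↔
      ∃ k : ℤ, Polynomial.aeval ζ q = k := by
    constructor
    · rintro ⟨k, hk⟩
      exact ⟨Nat.card G * k, by rw [← hν, hk, Int.cast_mul]⟩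
    · rintro ⟨k, hk⟩
      exact exists_eq_intCast_of_isIntegral_of_intCast_mul_eq
        (isIntegral_frobeniusSchurIndicator hn)
        (Int.natCast_ne_zero.2 Nat.card_pos.ne') (hν.trans hk)
  rw [hdenom, exists_intCast_eq_aeval_iff Nat.card_pos hζ, hone]
  simp only [isPrimitiveRoot_iff_exists_pow_eq Nat.card_pos hζ]
  constructor
  · intro h m hm hcop
    rw [hq m hm]
    exact h _ ⟨m, hm, hcop, rfl⟩
  · rintro h _ ⟨m, hm, hcop, rfl⟩
    rw [← hq m hm]
    exact h m hm hcop

theorem isFSZ_iff_twistedPower_eq {n : ℕ} (hn : 0 < n) :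
    IsFSZ n G ↔ ∀ m ≠ 0, (Nat.card G).Coprime m → twistedPower G n m = twistedPower G n 1 := by
  have hfin (V : Type u) [AddCommGroup V] [Module ℂ V] [Module (DrinfeldDouble G) V]
      [IsScalarTower ℂ (DrinfeldDouble G) V] [IsSimpleModule (DrinfeldDouble G) V] :
      FiniteDimensional ℂ V := Module.Finite.trans (DrinfeldDouble G) V
  constructor
  · intro h m hm hcop
    rw [← sub_eq_zero]
    refine eq_zero_of_mem_jacobson_bot (mem_jacobson_bot_of_moduleCharacter_eq_zero (K := ℂ)
      (sub_mem (twistedPower_mem_center n m) (twistedPower_mem_center n 1)) fun V ↦ ?_)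
    intros
    have := hfin V
    rw [map_sub, sub_eq_zero]
    exact (exists_intCast_eq_frobeniusSchurIndicator_iff hn V).1 (h V) m hm hcop
  · intro h V
    intros
    have := hfin V
    exact (exists_intCast_eq_frobeniusSchurIndicator_iff hn V).2 fun m hm hcop ↦ by rw [h m hm hcop]

theorem isFSZ_iff_ncard_rootSet_eq {n : ℕ} (hn : 0 < n) :
    IsFSZ n G ↔ ∀ m ≠ 0, (Nat.card G).Coprime m → ∀ u g : G, Commute u g →
      (rootSet n u (g ^ m)).ncard = (rootSet n u g).ncard := by
  simp_rw [isFSZ_iff_twistedPower_eq hn]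
  refine forall₃_congr fun m _ hm ↦ ?_
  rw [twistedPower_eq_twistedPower_one_iff n hm]
  refine forall₂_congr fun u g ↦ ⟨fun h _ ↦ h, fun h ↦ ?_⟩
  by_cases hug : Commute u g
  · exact h hug
  · have hugm : ¬Commute u (g ^ m) := mt (commute_of_commute_pow_of_coprime hm) hug
    rw [Set.eq_empty_of_forall_notMem fun a ha ↦ hug (commute_of_mem_rootSet ha),
      Set.eq_empty_of_forall_notMem fun a ha ↦ hugm (commute_of_mem_rootSet ha)]

end Criterion

end DrinfeldDouble

section EqualCharacters

open Representation

variable {K H V W V' W' : Type*} [Field K] [Group H]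
  [AddCommGroup V] [Module K V] [AddCommGroup W] [Module K W]
  [AddCommGroup V'] [Module K V'] [AddCommGroup W'] [Module K W']
  {ρ : Representation K H V} {σ : Representation K H W}
  {ρ' : Representation K H V'} {σ' : Representation K H W'}

theorem nonempty_prod_equiv_prod (e : ρ.Equiv σ) (e' : ρ'.Equiv σ') :
    Nonempty ((ρ.prod ρ').Equiv (σ.prod σ')) :=
  ⟨.mk (e.toLinearEquiv.prodCongr e'.toLinearEquiv) fun g ↦ LinearMap.ext fun x ↦
    Prod.ext (e.toIntertwiningMap.isIntertwining ρ σ g x.1)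
      (e'.toIntertwiningMap.isIntertwining ρ' σ' g x.2)⟩

theorem isCompl_toSubmodule {p q : Subrepresentation ρ} (h : IsCompl p q) :
    IsCompl p.toSubmodule q.toSubmodule :=
  .of_eq (congrArg Subrepresentation.toSubmodule h.inf_eq_bot)
    (congrArg Subrepresentation.toSubmodule h.sup_eq_top)

theorem nonempty_prod_equiv_of_isCompl {p q : Subrepresentation ρ} (h : IsCompl p q) :
    Nonempty ((p.toRepresentation.prod q.toRepresentation).Equiv ρ) :=
  ⟨.mk (Submodule.prodEquivOfIsCompl _ _ (isCompl_toSubmodule h)) fun g ↦ by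
    ext x <;> simp [Subrepresentation.toRepresentation]⟩

theorem nonempty_equiv_range_of_isCompl_ker (f : IntertwiningMap ρ σ) {p : Subrepresentation ρ}
    (h : IsCompl f.ker p) : Nonempty (p.toRepresentation.Equiv f.range.toRepresentation) := by
  have h' := isCompl_toSubmodule h
  let e : p.toSubmodule ≃ₗ[K] f.range.toSubmodule :=
    (Submodule.quotientEquivOfIsCompl _ _ h').symm ≪≫ₗ f.toLinearMap.quotKerEquivRange
  refine ⟨.mk e fun g ↦ LinearMap.ext fun x ↦ Subtype.ext ?_⟩
  exact f.isIntertwining ρ σ g x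

theorem character_prod [FiniteDimensional K V] [FiniteDimensional K V'] (g : H) :
    (ρ.prod ρ').character g = ρ.character g + ρ'.character g :=
  LinearMap.trace_prodMap' _ _

variable [CharZero K] [FiniteDimensional K V] [FiniteDimensional K W]

theorem finrank_eq_of_character_eq (h : ρ.character = σ.character) :
    Module.finrank K V = Module.finrank K W := by
  simpa [char_one] using congrFun h 1

variable [Finite H]

theorem exists_intertwiningMap_ne_zero_of_character_eq [Nontrivial V]
    (h : ρ.character = σ.character) : ∃ f : IntertwiningMap ρ σ, f ≠ 0 := by
  have := Fintype.ofFinite H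
  have : Invertible (Nat.card H : K) := invertibleOfNonzero (Nat.cast_ne_zero.2 Nat.card_pos.ne')
  have hid : Nontrivial (IntertwiningMap ρ ρ) := by
    obtain ⟨v, hv⟩ := exists_ne (0 : V)
    exact ⟨IntertwiningMap.id ρ, 0, fun he ↦ hv congr($he v)⟩
  have hfinrank : Module.finrank K (IntertwiningMap ρ σ) =
      Module.finrank K (IntertwiningMap ρ ρ) := by
    rw [← Nat.cast_inj (R := K), ← card_inv_mul_sum_char_mul_char_eq_finrank,
      ← card_inv_mul_sum_char_mul_char_eq_finrank, h]
  have : Nontrivial (IntertwiningMap ρ σ) :=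
    Module.nontrivial_of_finrank_pos (R := K) (hfinrank ▸ Module.finrank_pos)
  exact exists_ne 0

/-- A nonzero intertwining map splits off isomorphic direct summands of `ρ` and `σ`; the
complementary summands again have equal characters. -/
theorem nonempty_equiv_of_character_eq (h : ρ.character = σ.character) :
    Nonempty (ρ.Equiv σ) := by
  induction hd : Module.finrank K V using Nat.strong_induction_on generalizing V W with
  | _ d ih =>
  rcases subsingleton_or_nontrivial V with hV | hV
  · have hfinrank := finrank_eq_of_character_eq h
    exact ⟨.mk (LinearEquiv.ofFinrankEq V W hfinrank) fun g ↦ LinearMap.ext fun x ↦ by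
      simp [Subsingleton.elim x 0]⟩
  have : NeZero (Nat.card H : K) := ⟨Nat.cast_ne_zero.2 Nat.card_pos.ne'⟩
  have : IsSemisimpleRepresentation ρ :=
    (isSemisimpleRepresentation_iff_isSemisimpleModule_asModule ρ).2 inferInstance
  have : IsSemisimpleRepresentation σ :=
    (isSemisimpleRepresentation_iff_isSemisimpleModule_asModule σ).2 inferInstance
  obtain ⟨f, hf⟩ := exists_intertwiningMap_ne_zero_of_character_eq h
  obtain ⟨p, hp⟩ := exists_isCompl f.ker
  obtain ⟨q, hq⟩ := exists_isCompl f.range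
  obtain ⟨eV⟩ := nonempty_prod_equiv_of_isCompl hp
  obtain ⟨eW⟩ := nonempty_prod_equiv_of_isCompl hq.symm
  obtain ⟨e⟩ := nonempty_equiv_range_of_isCompl_ker f hp
  have hker : f.ker.toRepresentation.character = q.toRepresentation.character := by
    ext g
    have hg := congrFun h g
    rw [← char_iso eV, ← char_iso eW, character_prod, character_prod, char_iso e] at hg
    exact add_right_cancel hg
  have hlt : Module.finrank K f.ker.toSubmodule < d := by
    rw [← hd]
    refine Submodule.finrank_lt fun htop ↦ hf ?_
    ext x
    exact (htop ▸ Submodule.mem_top : x ∈ f.ker.toSubmodule)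
  obtain ⟨e'⟩ := ih _ hlt hker rfl
  obtain ⟨e''⟩ := nonempty_prod_equiv_prod e' e
  exact ⟨(eV.symm.trans e'').trans eW⟩

end EqualCharacters

section PermutationCharacters

variable {H X : Type*} [Group H] [MulAction H X] [Finite X]

instance moduleFinite_monoidAlgebra (K : Type*) [Semiring K] :
    Module.Finite K (MonoidAlgebra K X) :=
  Module.Finite.equiv (MonoidAlgebra.coeffLinearEquiv K (M := X)).symm

theorem character_ofMulAction (K : Type*) [Field K] (k : H) :
    (Representation.ofMulAction K H X).character k = Nat.card (MulAction.fixedBy X k) := by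
  classical
  have := Fintype.ofFinite X
  let b : Module.Basis X K (MonoidAlgebra K X) := .ofRepr (MonoidAlgebra.coeffLinearEquiv K)
  have hdiag (x : X) :
      (LinearMap.toMatrix b b (Representation.ofMulAction K H X k)).diag x =
        if k • x = x then 1 else 0 := by
    rw [Matrix.diag_apply, LinearMap.toMatrix_apply,
      show b x = MonoidAlgebra.single x 1 from rfl, Representation.ofMulAction_single]
    exact Finsupp.single_apply
  rw [Representation.character, LinearMap.trace_eq_matrix_trace K b, Matrix.trace]
  simp only [hdiag, Finset.sum_boole]
  rw [Nat.card_eq_fintype_card, Fintype.card_subtype]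
  rfl

end PermutationCharacters

section Centralizers

variable {G : Type u} [Group G]

theorem ncard_rootSet_centralizer (n : ℕ) (x : G) (u g : Subgroup.centralizer {x}) :
    (rootSet n u g).ncard = (rootSet n (u : G) g ∩ Subgroup.centralizer {x}).ncard := by
  have hpre : rootSet n u g = Subtype.val ⁻¹' rootSet n (u : G) g := by
    ext a
    simp [rootSet, ← Subtype.coe_inj]
  rw [hpre, ← Set.ncard_image_of_injective _ Subtype.val_injective, Set.inter_comm]
  exact congrArg Set.ncard (Subtype.image_preimage_coe _ _)

variable [Finite G]

theorem character_permRep (n : ℕ) (u g : G) {g' : G} (hg' : g' ∈ Subgroup.zpowers g)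
    (k : Subgroup.centralizer {u, g}) :
    (permRep n u g hg').character k =
      (rootSet n u g' ∩ Subgroup.centralizer {(k : G)}).ncard := by
  let _ := conjAction n u g hg'
  refine (character_ofMulAction ℂ k).trans ?_
  rw [Nat.card_coe_set_eq, ← Set.ncard_image_of_injective _ Subtype.val_injective,
    ← Subtype.image_preimage_coe]
  congr 3
  ext a
  rw [MulAction.mem_fixedBy, ← Subtype.coe_inj, Set.mem_preimage, SetLike.mem_coe,
    Subgroup.mem_centralizer_singleton_iff, eq_comm (a := (a : G) * k)]
  exact mul_inv_eq_iff_eq_mul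

theorem exists_pow_eq_zpow_of_gcd_card_eq_one (H : Subgroup G) {m : ℤ}
    (hm : Int.gcd m (Nat.card H) = 1) :
    ∃ k ≠ 0, (Nat.card G).Coprime k ∧ ∀ g ∈ H, g ^ k = g ^ m := by
  have : NeZero (Nat.card G) := ⟨Nat.card_pos.ne'⟩
  have hunit : IsUnit (m : ZMod (Nat.card H)) :=
    ZMod.coe_int_isUnit_iff_isCoprime m _ |>.2 (Int.isCoprime_iff_gcd_eq_one.2 hm).symm
  obtain ⟨v, hv⟩ := ZMod.unitsMap_surjective H.card_subgroup_dvd_card hunit.unit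
  let k := (v : ZMod (Nat.card G)).val
  have hkm : ((k : ℤ) : ZMod (Nat.card H)) = m := by
    have hval := congrArg Units.val hv
    rw [ZMod.unitsMap_val, IsUnit.unit_spec] at hval
    rw [← hval, Int.cast_natCast, ZMod.natCast_val]
  refine ⟨k + Nat.card G, by simp [Nat.card_pos.ne'],
    by simpa using (ZMod.val_coe_unit_coprime v).symm, fun g hg ↦ ?_⟩
  rw [pow_add, pow_card_eq_one', mul_one, ← zpow_natCast, zpow_eq_zpow_iff_modEq]
  exact ((ZMod.intCast_eq_intCast_iff _ _ _).1 hkm).of_dvd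
    (Int.natCast_dvd_natCast.2 (H.orderOf_dvd_natCard hg))

theorem isFSZPlus_iff_ncard_eq (n : ℕ) :
    IsFSZPlus n G ↔ ∀ x : G, ∀ m ≠ 0, (Nat.card G).Coprime m → ∀ u g : G,
      Commute x u → Commute x g → Commute u g →
      (rootSet n u (g ^ m) ∩ Subgroup.centralizer {x}).ncard =
        (rootSet n u g ∩ Subgroup.centralizer {x}).ncard := by
  constructor
  · intro h x m _ hm u g hxu hxg hug
    obtain ⟨e⟩ := h u g hug m (by simpa using hm.symm)
    have hx : x ∈ Subgroup.centralizer {u, g} := by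
      simp [Subgroup.mem_centralizer_iff, hxu.eq, hxg.eq]
    have hchar := congrFun (Representation.char_iso e) ⟨x, hx⟩
    rw [character_permRep, character_permRep] at hchar
    exact_mod_cast hchar.symm
  · intro h u g hug m hm
    obtain ⟨k, hk₀, hk, hpow⟩ := exists_pow_eq_zpow_of_gcd_card_eq_one (⊤ : Subgroup G)
      (by rwa [Subgroup.card_top])
    refine nonempty_equiv_of_character_eq (funext fun x ↦ ?_)
    have hx := Subgroup.mem_centralizer_iff.1 x.2
    rw [character_permRep, character_permRep, ← hpow g trivial,
      h x k hk₀ hk u g (hx u (by simp)).symm (hx g (by simp)).symm hug]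

theorem isFSZ_centralizer_iff_ncard_eq {n : ℕ} (hn : 0 < n) (x : G) :
    IsFSZ n (Subgroup.centralizer {x}) ↔ ∀ m ≠ 0, (Nat.card G).Coprime m → ∀ u g : G,
      Commute x u → Commute x g → Commute u g →
      (rootSet n u (g ^ m) ∩ Subgroup.centralizer {x}).ncard =
        (rootSet n u g ∩ Subgroup.centralizer {x}).ncard := by
  have hmem {a : G} : a ∈ Subgroup.centralizer {x} ↔ Commute x a := by
    rw [Subgroup.mem_centralizer_singleton_iff, commute_iff_eq, eq_comm]
  rw [DrinfeldDouble.isFSZ_iff_ncard_rootSet_eq hn]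
  simp only [ncard_rootSet_centralizer, Subgroup.coe_pow]
  constructor
  · intro h m hm₀ hm u g hxu hxg hug
    exact h m hm₀ (hm.coprime_dvd_left (Subgroup.card_subgroup_dvd_card _))
      ⟨u, hmem.2 hxu⟩ ⟨g, hmem.2 hxg⟩ (Subtype.ext hug)
  · intro h m _ hm u g hug
    obtain ⟨k, hk₀, hk, hpow⟩ := exists_pow_eq_zpow_of_gcd_card_eq_one (Subgroup.centralizer {x})
      (m := m) (by simpa using hm.symm)
    have hgk : (g : G) ^ m = (g : G) ^ k := by rw [hpow g g.2, zpow_natCast]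
    rw [hgk]
    exact h k hk₀ hk u g (hmem.1 u.2) (hmem.1 g.2) (congrArg Subtype.val hug)

theorem isFSZPlus_iff_forall_isFSZ_centralizer {n : ℕ} (hn : 0 < n) :
    IsFSZPlus n G ↔ ∀ x : G, IsFSZ n (Subgroup.centralizer {x}) := by
  simp only [isFSZPlus_iff_ncard_eq, isFSZ_centralizer_iff_ncard_eq hn]

/-- Every `a ∈ G_n(u, g)` commutes with `aⁿ = g`, so `G_n(u, g)` and `G_n(u, g ^ m)` lie in the
centralizer of `g`. -/
theorem isFSZ_centralizer_one_of_forall_ne_one {n : ℕ} (hn : 0 < n)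
    (h : ∀ x : G, x ≠ 1 → IsFSZ n (Subgroup.centralizer {x})) :
    IsFSZ n (Subgroup.centralizer {(1 : G)}) := by
  rw [isFSZ_centralizer_iff_ncard_eq hn]
  intro m hm₀ hm u g _ _ hug
  rcases eq_or_ne g 1 with rfl | hg
  · rw [one_pow]
  · have hsub {g' : G} (hg' : ∀ a, Commute a g' → Commute a g) :
        rootSet n u g' ⊆ Subgroup.centralizer {g} := fun a ha ↦
      Subgroup.mem_centralizer_singleton_iff.2 (hg' a (ha.2 ▸ Commute.self_pow a n))
    have hcard := (isFSZ_centralizer_iff_ncard_eq hn g).1 (h g hg) m hm₀ hm u g hug.symm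
      (Commute.refl g) hug
    rw [Set.inter_eq_left.2 (hsub fun _ ↦ commute_of_commute_pow_of_coprime hm),
      Set.inter_eq_left.2 (hsub fun _ ↦ id)] at hcard
    have hone : Subgroup.centralizer {(1 : G)} = ⊤ := by simp
    rwa [hone, Subgroup.coe_top, Set.inter_univ, Set.inter_univ]

end Centralizers

end

theorem mainTheorem3 {G : Type*} [Group G] [Finite G] (n : ℕ) (hn : 0 < n) :
    IsFSZPlus n G ↔ ∀ h : G, h ≠ 1 → IsFSZ n (Subgroup.centralizer {h} : Subgroup G) := by
  rw [isFSZPlus_iff_forall_isFSZ_centralizer hn]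
  refine ⟨fun hall h _ ↦ hall h, fun hne h ↦ ?_⟩
  rcases eq_or_ne h 1 with rfl | hh
  · exact isFSZ_centralizer_one_of_forall_ne_one hn hne
  · exact hne h hh
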